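/- All rings are associative with unity, not necessarily commutative. Let $R$ be a subring of a ring $A$ and let $x_1,\dots,x_n\in A$. Suppose that $A=\sigma(R)\langle x_1,\dots,x_n\rangle$ is a skew PBW extension of $R$, that is: (a) $A$ is a free left $R$-module with basis the monomials $x^\alpha=x_1^{\alpha_1}\cdots x_n^{\alpha_n}$, $\alpha\in\mathbb N^n$ (with $x^0=1$); (b) for each $1\le i\le n$ and each $r\in R\setminus\{0\}$ there is $c_{i,r}\in R\setminus\{0\}$ with $x_ir-c_{i,r}x_i\in R$; (c) for all $1\le i,j\le n$ there is $c_{i,j}\in R\setminus\{0\}$ with $x_jx_i-c_{i,j}x_ix_j\in R+Rx_1+\cdots+Rx_n$. Suppose that $R$ is skew-Armendariz, that is: whenever $f=\sum_\alpha a_\alpha x^\alpha$ and $g=\sum_\beta b_\beta x^\beta$ in $A$ (finite sums, with coefficients in $R$) satisfy $fg=0$, then $a_0b_\beta=0$ for every $\beta\in\mathbb N^n$, where $a_0$ is the constant coefficient of $f$. A ring $B$ is *quasi-Baer* if the right annihilator of every two-sided ideal of $B$ is of the form $eB$ with $e^2=e\in B$; it is *right* (resp. *left*) *p.q.-Baer*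 if for every $a\in B$ the right annihilator of $aB$ is $eB$ (resp. the left annihilator of $Ba$ is $Be$) for some $e^2=e\in B$; it has *IFP* if for every $a\in B$ the right annihilator $\{b\in B: ab=0\}$ is a two-sided ideal of $B$. Then: 1. $R$ is quasi-Baer with IFP if and only if $A$ is quasi-Baer with IFP; 2. $R$ is right p.q.-Baer with IFP if and only if $A$ is right p.q.-Baer with IFP; 3. $R$ is left p.q.-Baer with IFP if and only if $A$ is left p.q.-Baer with IFP. -/

import Mathlib

/-- The right annihilator `r_B(S) = {b | s b = 0 for all s ∈ S}`. -/
def rightAnnihilator {B : Type*} [Ring B] (S : Set B) : Set B :=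
  {b | ∀ s ∈ S, s * b = 0}

/-- The left annihilator `l_B(S) = {b | b s = 0 for all s ∈ S}`. -/
def leftAnnihilator {B : Type*} [Ring B] (S : Set B) : Set B :=
  {b | ∀ s ∈ S, b * s = 0}

/-- The principal right ideal `aB`, as a set. -/
def principalRightIdeal {B : Type*} [Ring B] (a : B) : Set B :=
  Set.range fun b : B => a * b

/-- The principal left ideal `Ba`, as a set. -/
def principalLeftIdeal {B : Type*} [Ring B] (a : B) : Set B :=
  Set.range fun b : B => b * a

/-- `B` is quasi-Baer: the right annihilator of every (two-sided) ideal is `eB` for some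
idempotent `e`. -/
def IsQuasiBaer (B : Type*) [Ring B] : Prop :=
  ∀ I : TwoSidedIdeal B, ∃ e : B, IsIdempotentElem e ∧
    rightAnnihilator (I : Set B) = principalRightIdeal e

/-- `B` is right p.q.-Baer: the right annihilator of every principal right ideal `aB` is `eB` for
some idempotent `e`. -/
def IsRightPQBaer (B : Type*) [Ring B] : Prop :=
  ∀ a : B, ∃ e : B, IsIdempotentElem e ∧
    rightAnnihilator (principalRightIdeal a) = principalRightIdeal e

/-- `B` is left p.q.-Baer: the left annihilator of every principal left ideal `Ba` is `Be` for
some idempotent `e`. -/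
def IsLeftPQBaer (B : Type*) [Ring B] : Prop :=
  ∀ a : B, ∃ e : B, IsIdempotentElem e ∧
    leftAnnihilator (principalLeftIdeal a) = principalLeftIdeal e

/-- The insertion of factors property: `r_B(a)` is a two-sided ideal for every `a ∈ B`. -/
def HasIFP (B : Type*) [Ring B] : Prop :=
  ∀ a : B, ∃ I : TwoSidedIdeal B, (I : Set B) = rightAnnihilator {a}

/-- The standard monomial `x^α = x₁^{α₁} ⋯ xₙ^{αₙ}`, the factors taken in this order. -/
def standardMonomial {A : Type*} [Ring A] {n : ℕ} (x : Fin n → A) (α : Fin n → ℕ) : A :=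
  (List.ofFn fun i => x i ^ α i).prod

/-- `A` is a skew PBW extension `σ(R)⟨x₁, …, xₙ⟩` of its subring `R`. -/
structure IsSkewPBWExtension {A : Type*} [Ring A] (R : Subring A) {n : ℕ} (x : Fin n → A) :
    Prop where
  linearIndependent : LinearIndependent R (standardMonomial x)
  span_eq_top : Submodule.span R (Set.range (standardMonomial x)) = ⊤
  exists_mul_coeff : ∀ (i : Fin n) (r : R), r ≠ 0 →
    ∃ c : R, c ≠ 0 ∧ x i * (r : A) - (c : A) * x i ∈ R
  exists_mul_var : ∀ i j : Fin n, ∃ c : R, c ≠ 0 ∧ ∃ (r₀ : R) (r : Fin n → R),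
    x j * x i - (c : A) * (x i * x j) = (r₀ : A) + ∑ k, (r k : A) * x k

/-- The element `∑ α, a_α x^α` of `A` with coefficients `a_α ∈ R`. -/
def skewPolynomial {A : Type*} [Ring A] {R : Subring A} {n : ℕ} (x : Fin n → A)
    (a : (Fin n → ℕ) →₀ R) : A :=
  a.sum fun α r => (r : A) * standardMonomial x α

/-- `R` is skew-Armendariz with respect to `x₁, …, xₙ`: whenever
`(∑ α, a_α x^α) (∑ β, b_β x^β) = 0`, the constant coefficient `a_0` of the first factor
annihilates every coefficient `b_β` of the second, i.e. `a_0 b_β = 0`. -/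
def IsSkewArmendariz {A : Type*} [Ring A] (R : Subring A) {n : ℕ} (x : Fin n → A) : Prop :=
  ∀ a b : (Fin n → ℕ) →₀ R, skewPolynomial x a * skewPolynomial x b = 0 →
    ∀ β : Fin n → ℕ, a 0 * b β = 0

/-! IFP makes idempotents central, so each of the three conditions becomes a statement about right
annihilators cut out by a central idempotent: of singletons in the two p.q.-Baer cases, of arbitrary
subsets in the quasi-Baer case. Conversely, such idempotents for singletons force the ring to be
reduced, hence IFP and with left and right annihilators equal.

The transfer rests on three facts. Idempotents of `A` lie in `R` (`idempotent_mem`), which gives the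
passage from `A` to `R`. Central idempotents of `R` are central in `A` (`idempotent_central`). If
`fg = 0`, then every coefficient of `f` annihilates every coefficient of `g`
(`coeff_mul_coeff_eq_zero`), so the annihilator of a set in `A` is governed by that of its
coefficients. The third is proved by comparing terms of top total degree, then splitting along the
idempotent that generates the annihilator of a leading coefficient. -/

/-! ### Baer-type conditions as central annihilator idempotents -/

section AnnihilatorIdempotents

variable {B : Type*} [Ring B]

/-- The right annihilator of `S` is generated by a central idempotent. -/
def HasCentralAnnihilator (S : Set B) : Prop :=
  ∃ e : B, e * e = e ∧ (∀ b, e * b = b * e) ∧ ∀ b, (∀ s ∈ S, s * b = 0) ↔ e * b = b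

theorem hasIFP_iff : HasIFP B ↔ ∀ a b c : B, a * b = 0 → a * c * b = 0 := by
  constructor
  · intro h a b c hab
    obtain ⟨I, hI⟩ := h a
    have hmem : ∀ y, y ∈ I ↔ a * y = 0 := fun y => by
      have := Set.ext_iff.1 hI y
      simpa [rightAnnihilator] using this
    rw [mul_assoc]
    exact (hmem _).1 (I.mul_mem_left c b ((hmem b).2 hab))
  · intro h a
    refine ⟨TwoSidedIdeal.mk' (rightAnnihilator {a}) ?_ ?_ ?_ ?_ ?_, ?_⟩
    · simp [rightAnnihilator]
    · intro y z hy hz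
      simp_all [rightAnnihilator, mul_add]
    · intro y hy
      simp_all [rightAnnihilator]
    · intro y z hz
      simp only [rightAnnihilator, Set.mem_singleton_iff, forall_eq, Set.mem_ofPred_eq] at hz ⊢
      rw [← mul_assoc]
      exact h a z y hz
    · intro y z hy
      simp only [rightAnnihilator, Set.mem_singleton_iff, forall_eq, Set.mem_ofPred_eq] at hy ⊢
      rw [← mul_assoc, hy, zero_mul]
    · ext y
      simp

/-- Inserting `b` into `e(1 - e) = 0` and `(1 - e)e = 0` gives `eb = ebe = be`. -/
theorem HasIFP.idempotent_comm (h : HasIFP B) {e : B} (he : e * e = e) (b : B) :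
    e * b = b * e := by
  rw [hasIFP_iff] at h
  have h1 := h e (1 - e) b (by rw [mul_sub, he, mul_one, sub_self])
  have h2 := h (1 - e) e b (by rw [sub_mul, he, one_mul, sub_self])
  rw [mul_sub, mul_one, sub_eq_zero] at h1
  rw [sub_mul, sub_mul, one_mul, sub_eq_zero] at h2
  rw [h1, h2]

theorem mem_principalRightIdeal_iff {e : B} (he : e * e = e) (b : B) :
    b ∈ principalRightIdeal e ↔ e * b = b := by
  constructor
  · rintro ⟨c, rfl⟩
    simp only [← mul_assoc, he]
  · exact fun h => ⟨b, h⟩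

theorem mem_principalLeftIdeal_iff {e : B} (he : e * e = e) (b : B) :
    b ∈ principalLeftIdeal e ↔ b * e = b := by
  constructor
  · rintro ⟨c, rfl⟩
    simp only [mul_assoc, he]
  · exact fun h => ⟨b, h⟩

/-- Both `a` and `e` annihilate `a` on the right, so `a = ea = ae = 0`. -/
theorem eq_zero_of_mul_self (h : ∀ a : B, HasCentralAnnihilator {a}) {a : B} (ha : a * a = 0) :
    a = 0 := by
  obtain ⟨e, he, hc, h⟩ := h a
  have h1 := (h a).1 (by simpa using ha)
  have h2 := (h e).2 he a rfl
  rw [← h1, hc, h2]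

theorem mul_eq_zero_swap (h : ∀ a : B, a * a = 0 → a = 0) {a b : B} (hab : a * b = 0) :
    b * a = 0 := by
  apply h
  rw [mul_assoc, ← mul_assoc a, hab, zero_mul, mul_zero]

theorem hasIFP_of_reduced (h : ∀ a : B, a * a = 0 → a = 0) : HasIFP B := by
  rw [hasIFP_iff]
  intro a b c hab
  apply h
  have : a * c * b * (a * c * b) = a * c * (b * a) * c * b := by simp only [mul_assoc]
  rw [this, mul_eq_zero_swap h hab]
  simp

theorem mem_rightAnnihilator_principalRightIdeal (h : HasIFP B) (a b : B) :
    b ∈ rightAnnihilator (principalRightIdeal a) ↔ a * b = 0 := by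
  rw [hasIFP_iff] at h
  constructor
  · intro hb
    exact hb a ⟨1, mul_one a⟩
  · rintro hb _ ⟨c, rfl⟩
    exact h a b c hb

theorem mem_leftAnnihilator_principalLeftIdeal (h : HasIFP B) (a b : B) :
    b ∈ leftAnnihilator (principalLeftIdeal a) ↔ b * a = 0 := by
  rw [hasIFP_iff] at h
  constructor
  · intro hb
    exact hb a ⟨1, one_mul a⟩
  · rintro hb _ ⟨c, rfl⟩
    show b * (c * a) = 0
    rw [← mul_assoc]
    exact h b a c hb

theorem isRightPQBaer_and_hasIFP_iff :
    (IsRightPQBaer B ∧ HasIFP B) ↔ ∀ a : B, HasCentralAnnihilator {a} := by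
  constructor
  · rintro ⟨h, hI⟩ a
    obtain ⟨e, he, hr⟩ := h a
    refine ⟨e, he, hI.idempotent_comm he, fun b => ?_⟩
    rw [← mem_principalRightIdeal_iff he, ← hr, mem_rightAnnihilator_principalRightIdeal hI]
    simp
  · intro h
    have hI : HasIFP B := hasIFP_of_reduced fun _ => eq_zero_of_mul_self h
    refine ⟨fun a => ?_, hI⟩
    obtain ⟨e, he, -, hr⟩ := h a
    refine ⟨e, he, ?_⟩
    ext b
    rw [mem_principalRightIdeal_iff he, ← hr, mem_rightAnnihilator_principalRightIdeal hI]
    simp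

/-- Either side forces `B` to be reduced, and there `ab = 0` if and only if `ba = 0`, so the left
condition has the same form as the right one. -/
theorem isLeftPQBaer_and_hasIFP_iff :
    (IsLeftPQBaer B ∧ HasIFP B) ↔ ∀ a : B, HasCentralAnnihilator {a} := by
  constructor
  · rintro ⟨h, hI⟩
    have key : ∀ a : B, ∃ e : B, e * e = e ∧ (∀ b, e * b = b * e) ∧
        ∀ b, b * a = 0 ↔ e * b = b := by
      intro a
      obtain ⟨e, he, hr⟩ := h a
      have hc := hI.idempotent_comm he
      refine ⟨e, he, hc, fun b => ?_⟩
      rw [hc, ← mem_principalLeftIdeal_iff he, ← hr, mem_leftAnnihilator_principalLeftIdeal hI]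
    have hred : ∀ a : B, a * a = 0 → a = 0 := by
      intro a ha
      obtain ⟨e, he, -, h⟩ := key a
      rw [← (h a).1 ha, (h e).2 he]
    intro a
    obtain ⟨e, he, hc, hr⟩ := key a
    refine ⟨e, he, hc, fun b => ?_⟩
    rw [← hr]
    simp only [Set.mem_singleton_iff, forall_eq]
    exact ⟨mul_eq_zero_swap hred, mul_eq_zero_swap hred⟩
  · intro h
    have hred : ∀ a : B, a * a = 0 → a = 0 := fun _ => eq_zero_of_mul_self h
    have hI : HasIFP B := hasIFP_of_reduced hred
    refine ⟨fun a => ?_, hI⟩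
    obtain ⟨e, he, hc, hr⟩ := h a
    refine ⟨e, he, ?_⟩
    ext b
    rw [mem_principalLeftIdeal_iff he, ← hc, ← hr, mem_leftAnnihilator_principalLeftIdeal hI]
    simp only [Set.mem_singleton_iff, forall_eq]
    exact ⟨mul_eq_zero_swap hred, mul_eq_zero_swap hred⟩

/-- Under IFP the left annihilator of `b` is a two-sided ideal, so it contains the span as soon as
it contains `S`. -/
theorem mem_rightAnnihilator_span (h : HasIFP B) (S : Set B) (b : B) :
    b ∈ rightAnnihilator (TwoSidedIdeal.span S : Set B) ↔ ∀ s ∈ S, s * b = 0 := by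
  rw [hasIFP_iff] at h
  constructor
  · intro hb s hs
    exact hb s (TwoSidedIdeal.subset_span hs)
  · intro hb s hs
    let I : TwoSidedIdeal B := TwoSidedIdeal.mk' {y | y * b = 0} (by simp)
      (fun {y z} (hy : y * b = 0) (hz : z * b = 0) => by
        show (y + z) * b = 0
        rw [add_mul, hy, hz, add_zero])
      (fun {y} (hy : y * b = 0) => by
        show -y * b = 0
        rw [neg_mul, hy, neg_zero])
      (fun {y z} (hz : z * b = 0) => by
        show y * z * b = 0
        rw [mul_assoc, hz, mul_zero])
      (fun {y z} (hy : y * b = 0) => h y b z hy)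
    have hI : ∀ y, y ∈ I ↔ y * b = 0 := fun y => by simp [I]
    have hle : TwoSidedIdeal.span S ≤ I :=
      TwoSidedIdeal.span_le.2 fun y hy => (hI y).2 (hb y hy)
    exact (hI s).1 (hle hs)

theorem isQuasiBaer_and_hasIFP_iff :
    (IsQuasiBaer B ∧ HasIFP B) ↔ ∀ S : Set B, HasCentralAnnihilator S := by
  constructor
  · rintro ⟨h, hI⟩ S
    obtain ⟨e, he, hr⟩ := h (TwoSidedIdeal.span S)
    refine ⟨e, he, hI.idempotent_comm he, fun b => ?_⟩
    rw [← mem_principalRightIdeal_iff he, ← hr, mem_rightAnnihilator_span hI]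
  · intro h
    have hI : HasIFP B := hasIFP_of_reduced fun _ => eq_zero_of_mul_self fun a => h {a}
    refine ⟨fun I => ?_, hI⟩
    obtain ⟨e, he, -, hr⟩ := h I
    refine ⟨e, he, ?_⟩
    ext b
    rw [mem_principalRightIdeal_iff he, ← hr]
    rfl

/-- For commuting idempotents, `eB ∩ fB = efB`. -/
theorem hasCentralAnnihilator_finset (h : ∀ a : B, HasCentralAnnihilator {a}) (S : Finset B) :
    HasCentralAnnihilator (S : Set B) := by
  classical
  induction S using Finset.induction_on with
  | empty => exact ⟨1, by simp, by simp, by simp⟩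
  | insert a S _ ih =>
    obtain ⟨e, he, hc, hr⟩ := h a
    obtain ⟨f, hf, hd, ht⟩ := ih
    refine ⟨e * f, ?_, fun b => ?_, fun b => ?_⟩
    · rw [mul_assoc, ← mul_assoc f, hd e, mul_assoc, hf, ← mul_assoc, he]
    · rw [mul_assoc, hd, ← mul_assoc, hc, mul_assoc]
    · have h1 := hr b
      have h2 := ht b
      simp only [Set.mem_singleton_iff, forall_eq] at h1
      simp only [Finset.coe_insert, Set.mem_insert_iff, forall_eq_or_imp]
      rw [h1, h2]
      constructor
      · rintro ⟨h3, h4⟩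
        rw [mul_assoc, h4, h3]
      · intro h3
        constructor
        · rw [← h3]
          simp only [← mul_assoc, he]
        · rw [← h3, hc f]
          simp only [← mul_assoc, hf]

end AnnihilatorIdempotents

/-! ### Coefficients in a skew PBW extension -/

section SkewPBW

variable {A : Type*} [Ring A] {R : Subring A} {n : ℕ} {x : Fin n → A}

/-- The basis of standard monomials. -/
noncomputable def IsSkewPBWExtension.basis (hA : IsSkewPBWExtension R x) :
    Module.Basis (Fin n → ℕ) R A :=
  Module.Basis.mk hA.linearIndependent hA.span_eq_top.ge

/-- The coefficients of an element with respect to the standard monomials. -/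
noncomputable def IsSkewPBWExtension.coeff (hA : IsSkewPBWExtension R x) :
    A →ₗ[R] ((Fin n → ℕ) →₀ R) :=
  hA.basis.repr.toLinearMap

theorem subring_smul (r : R) (a : A) : r • a = (r : A) * a := rfl

theorem coeff_standardMonomial (hA : IsSkewPBWExtension R x) (α : Fin n → ℕ) :
    hA.coeff (standardMonomial x α) = Finsupp.single α 1 := by
  have : standardMonomial x α = hA.basis α := by simp [IsSkewPBWExtension.basis]
  rw [this]
  simp [IsSkewPBWExtension.coeff]

theorem coeff_mul (hA : IsSkewPBWExtension R x) (r : R) (a : A) :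
    hA.coeff ((r : A) * a) = r • hA.coeff a := by
  rw [← subring_smul, map_smul]

theorem coeff_injective (hA : IsSkewPBWExtension R x) {f g : A} (h : hA.coeff f = hA.coeff g) :
    f = g :=
  hA.basis.repr.injective h

theorem skewPolynomial_coeff (hA : IsSkewPBWExtension R x) (f : A) :
    skewPolynomial x (hA.coeff f) = f := by
  have := hA.basis.linearCombination_repr f
  rw [Finsupp.linearCombination_apply] at this
  rw [skewPolynomial]
  simpa [IsSkewPBWExtension.basis, IsSkewPBWExtension.coeff, subring_smul] using this

theorem eq_sum_coeff (hA : IsSkewPBWExtension R x) (f : A) :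
    f = ∑ α ∈ (hA.coeff f).support, (hA.coeff f α : A) * standardMonomial x α :=
  (skewPolynomial_coeff hA f).symm

theorem standardMonomial_zero : standardMonomial x 0 = 1 := by
  simp [standardMonomial]

theorem coeff_coe (hA : IsSkewPBWExtension R x) (r : R) :
    hA.coeff (r : A) = Finsupp.single 0 r := by
  rw [← mul_one (r : A), coeff_mul, ← standardMonomial_zero, coeff_standardMonomial]
  simp

theorem coeff_one (hA : IsSkewPBWExtension R x) : hA.coeff (1 : A) = Finsupp.single 0 1 :=
  coeff_coe hA 1

theorem IsSkewArmendariz.coeff_mul_eq_zero (hA : IsSkewPBWExtension R x)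
    (hR : IsSkewArmendariz R x) {f g : A} (h : f * g = 0) (β : Fin n → ℕ) :
    hA.coeff f 0 * hA.coeff g β = 0 := by
  apply hR
  rwa [skewPolynomial_coeff, skewPolynomial_coeff]

/-! ### Words in the variables -/

/-- The product of the variables along a word. -/
def wordProd (x : Fin n → A) (w : List (Fin n)) : A := (w.map x).prod

theorem wordProd_cons (i : Fin n) (w : List (Fin n)) :
    wordProd x (i :: w) = x i * wordProd x w := by
  simp [wordProd]

theorem wordProd_append (v w : List (Fin n)) :
    wordProd x (v ++ w) = wordProd x v * wordProd x w := by
  simp [wordProd]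

/-- The nondecreasing word with prescribed multiplicities. -/
def standardWord (α : Fin n → ℕ) : List (Fin n) :=
  (List.ofFn fun i => List.replicate (α i) i).flatten

theorem wordProd_standardWord (α : Fin n → ℕ) :
    wordProd x (standardWord α) = standardMonomial x α := by
  simp only [wordProd, standardWord, standardMonomial, List.map_flatten, List.prod_flatten,
    List.map_ofFn]
  congr 2
  funext i
  simp

theorem count_standardWord (α : Fin n → ℕ) (i : Fin n) : (standardWord α).count i = α i := by
  simp only [standardWord, List.count_flatten, List.map_ofFn, List.sum_ofFn, Function.comp_apply,
    List.count_replicate]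
  simp

theorem length_standardWord (α : Fin n → ℕ) : (standardWord α).length = ∑ i, α i := by
  simp only [standardWord, List.length_flatten, List.map_ofFn, List.sum_ofFn, Function.comp_apply,
    List.length_replicate]

theorem perm_standardWord_count (w : List (Fin n)) :
    w.Perm (standardWord fun i => w.count i) := by
  rw [List.perm_iff_count]
  intro i
  rw [count_standardWord]

theorem pairwise_standardWord (α : Fin n → ℕ) : (standardWord α).Pairwise (· ≤ ·) := by
  rw [standardWord, List.pairwise_flatten]
  constructor
  · intro l hl
    rw [List.mem_ofFn] at hl
    obtain ⟨i, rfl⟩ := hl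
    rw [List.pairwise_replicate]
    exact Or.inr le_rfl
  · rw [List.pairwise_ofFn]
    intro i j hij a ha b hb
    rw [List.eq_of_mem_replicate ha, List.eq_of_mem_replicate hb]
    exact hij.le

theorem wordProd_eq_standardMonomial {w : List (Fin n)} (hw : w.Pairwise (· ≤ ·)) :
    wordProd x w = standardMonomial x fun i => w.count i := by
  rw [← wordProd_standardWord]
  congr 1
  exact (perm_standardWord_count w).eq_of_pairwise (fun a b _ _ => le_antisymm) hw
    (pairwise_standardWord _)

theorem var_eq_standardMonomial (i : Fin n) : x i = standardMonomial x (Pi.single i 1) := by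
  have := wordProd_eq_standardMonomial (x := x) (w := [i]) (by simp)
  simp only [wordProd, List.map_cons, List.map_nil, List.prod_cons, List.prod_nil, mul_one] at this
  conv_lhs => rw [this]
  congr 1
  funext j
  by_cases h : j = i
  · simp [h]
  · simp [h, Ne.symm h]

theorem coeff_var (hA : IsSkewPBWExtension R x) (i : Fin n) :
    hA.coeff (x i) = Finsupp.single (Pi.single i 1) 1 := by
  rw [var_eq_standardMonomial (x := x), coeff_standardMonomial]

theorem pi_single_one_ne_zero (i : Fin n) : (Pi.single i 1 : Fin n → ℕ) ≠ 0 := by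
  simp

/-- Form of axiom (b) that also covers `r = 0`; the last clause is the injectivity of `r ↦ s`. -/
theorem exists_mul_coe (hA : IsSkewPBWExtension R x) (i : Fin n) (r : R) :
    ∃ s t : R, x i * r = s * x i + t ∧ (s = 0 → r = 0) := by
  by_cases hr : r = 0
  · exact ⟨0, 0, by simp [hr], fun _ => hr⟩
  · obtain ⟨c, hc, hm⟩ := hA.exists_mul_coeff i r hr
    exact ⟨c, ⟨_, hm⟩, by simp, fun h => absurd h hc⟩

theorem var_linear_ext (hA : IsSkewPBWExtension R x) {i : Fin n} {s t s' t' : R}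
    (h : (s : A) * x i + t = s' * x i + t') : s = s' ∧ t = t' := by
  have h1 := congrArg hA.coeff h
  simp only [map_add, coeff_mul, coeff_var, coeff_coe] at h1
  have h2 := DFunLike.congr_fun h1 (Pi.single i 1)
  have h3 := DFunLike.congr_fun h1 0
  constructor
  · simpa [Finsupp.single_apply, pi_single_one_ne_zero, (pi_single_one_ne_zero i).symm] using h2
  · simpa [Finsupp.single_apply, pi_single_one_ne_zero, (pi_single_one_ne_zero i).symm] using h3

/-! ### Idempotents -/

/-- The relation forces `s` to be idempotent, which makes an explicit product of two linear elements
vanish; the skew-Armendariz condition then applies. -/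
theorem one_sub_mul_eq_zero_of_var_mul (hA : IsSkewPBWExtension R x) (hR : IsSkewArmendariz R x)
    {i : Fin n} {e s : R} (he : e * e = e) (h : x i * e = s * x i) : (1 - e) * s = 0 := by
  have hss : s * s = s := by
    have h1 : ((s * s : R) : A) * x i + (0 : R) = s * x i + (0 : R) := by
      push_cast
      rw [mul_assoc, ← h, ← mul_assoc, ← h, mul_assoc, ← Subring.coe_mul, he]
    exact (var_linear_ext hA h1).1
  have heA : (e : A) * e = e := by exact_mod_cast congrArg Subtype.val he
  have hssA : (s : A) * s = s := by exact_mod_cast congrArg Subtype.val hss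
  -- The constant coefficient on the left is `1 - e`, and the coefficient of `x i` on the right is
  -- `-(1 - e)s`; their product is `-(1 - e)s`.
  have hprod : ((1 - e : R) + ((1 - e) * s : R) * x i) * ((e : A) - ((1 - e) * s : R) * x i)
      = 0 := by
    push_cast
    have h1 : (1 - (e : A)) * e = 0 := by rw [sub_mul, heA, one_mul, sub_self]
    have h2 : (1 - (e : A)) * (1 - e) = 1 - e := by
      rw [mul_sub, h1, mul_one, sub_zero]
    have h3 : (s : A) * x i * (1 - e) = 0 := by
      rw [mul_assoc, mul_sub, h, mul_one, mul_sub, ← mul_assoc, hssA, sub_self]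
    calc (1 - (e : A) + (1 - e) * s * x i) * (e - (1 - e) * s * x i)
        = (1 - (e : A)) * e - ((1 - e) * (1 - e)) * s * x i + (1 - e) * s * (x i * e)
          - (1 - e) * (s * x i * (1 - e)) * s * x i := by noncomm_ring
      _ = 0 := by
        rw [h1, h2, h3, h, mul_assoc (1 - (e : A)) s (s * x i), ← mul_assoc (s : A), hssA]
        noncomm_ring
  have := hR.coeff_mul_eq_zero hA hprod (Pi.single i 1)
  simp only [map_add, map_sub, coeff_mul, coeff_var, coeff_coe] at this
  have h4 : (1 - e) * (1 - e) = 1 - e := by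
    rw [mul_sub, sub_mul, sub_mul, he]; simp
  simpa [Finsupp.single_apply, pi_single_one_ne_zero, (pi_single_one_ne_zero i).symm,
    ← mul_assoc, h4] using this

/-- Write `x i * e = s * x i + t`. Multiplying `x i * e` by `1 - e` and `x i * (1 - e)` by `e` gives
zero, and the constant terms yield `t(1 - e) = 0 = te`, so `t = 0`. -/
theorem var_mul_idempotent (hA : IsSkewPBWExtension R x) (hR : IsSkewArmendariz R x)
    (i : Fin n) {e : R} (he : e * e = e) : x i * e = e * x i := by
  obtain ⟨s, t, hst, -⟩ := exists_mul_coe hA i e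
  have heA : (e : A) * e = e := by exact_mod_cast congrArg Subtype.val he
  have h1 : ((s : A) * x i + t) * (1 - e : R) = 0 := by
    rw [← hst]
    push_cast
    rw [mul_assoc, mul_sub, heA, mul_one, sub_self, mul_zero]
  have h2 : ((1 - s : R) * x i - (t : A)) * (e : R) = 0 := by
    have : ((1 - s : R) * x i - (t : A)) = x i * (1 - e) := by
      rw [mul_sub, hst]
      push_cast
      noncomm_ring
    rw [this, mul_assoc, sub_mul, heA, one_mul, sub_self, mul_zero]
  have h3 := hR.coeff_mul_eq_zero hA h1 0
  have h4 := hR.coeff_mul_eq_zero hA h2 0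
  simp only [map_add, map_sub, coeff_mul, coeff_var, coeff_coe] at h3 h4
  simp only [Finsupp.add_apply, Finsupp.sub_apply, Finsupp.smul_apply, Finsupp.single_apply,
    pi_single_one_ne_zero, if_true, if_false, smul_zero, zero_add, zero_sub, neg_mul,
    neg_eq_zero] at h3 h4
  have ht : t = 0 := by rw [mul_sub, h4, mul_one, sub_zero] at h3; exact h3
  have hs : x i * e = s * x i := by rw [hst, ht]; simp
  have h5 := one_sub_mul_eq_zero_of_var_mul hA hR he hs
  -- The same lemma for the complementary idempotent: together they give `s = es = e`.
  have h6 := one_sub_mul_eq_zero_of_var_mul hA hR (e := 1 - e) (s := 1 - s) (i := i)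
    (by rw [mul_sub, sub_mul, sub_mul, he]; simp)
    (by push_cast; rw [mul_sub, hs, sub_mul, mul_one, one_mul])
  rw [sub_sub_cancel, mul_sub, mul_one, sub_eq_zero] at h6
  rw [sub_mul, one_mul, sub_eq_zero] at h5
  rw [hs, h5, ← h6]

theorem standardMonomial_mul_comm {a : A} (h : ∀ i, x i * a = a * x i) (α : Fin n → ℕ) :
    standardMonomial x α * a = a * standardMonomial x α := by
  have : Commute (List.ofFn fun i => x i ^ α i).prod a := by
    apply Commute.list_prod_left
    intro y hy
    rw [List.mem_ofFn] at hy
    obtain ⟨i, rfl⟩ := hy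
    exact Commute.pow_left (h i) _
  exact this

theorem idempotent_central (hA : IsSkewPBWExtension R x) (hR : IsSkewArmendariz R x)
    {e : R} (he : e * e = e) (hc : ∀ r : R, e * r = r * e) (f : A) : (e : A) * f = f * e := by
  rw [eq_sum_coeff hA f, Finset.mul_sum, Finset.sum_mul]
  refine Finset.sum_congr rfl fun α _ => ?_
  rw [mul_assoc, standardMonomial_mul_comm (fun i => var_mul_idempotent hA hR i he), ← mul_assoc,
    ← mul_assoc, ← Subring.coe_mul, hc, Subring.coe_mul]

/-- With `e₀` the constant coefficient and `e_β` another, `e(1 - e) = 0` gives `e₀ e_β = 0` and `(1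
- e)e = 0` gives `(1 - e₀) e_β = 0`, so `e_β = 0`. -/
theorem idempotent_mem (hA : IsSkewPBWExtension R x) (hR : IsSkewArmendariz R x)
    {e : A} (he : e * e = e) : e ∈ R := by
  have h1 := hR.coeff_mul_eq_zero hA (f := e) (g := 1 - e) (by rw [mul_sub, he]; simp)
  have h2 := hR.coeff_mul_eq_zero hA (f := 1 - e) (g := e) (by rw [sub_mul, he]; simp)
  have : e = (hA.coeff e 0 : A) := by
    apply coeff_injective hA
    rw [coeff_coe]
    ext1 β
    by_cases hβ : β = 0
    · simp [hβ]
    · have h3 := h1 β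
      have h4 := h2 β
      simp only [map_sub, coeff_one, Finsupp.sub_apply, Finsupp.single_eq_same,
        Finsupp.single_eq_of_ne hβ, zero_sub, mul_neg, neg_eq_zero, sub_mul, one_mul] at h3 h4
      rw [Finsupp.single_eq_of_ne hβ]
      rw [h3, sub_zero] at h4
      exact h4
  rw [this]
  exact (hA.coeff e 0).2

/-! ### The filtration by word length -/

/-- The left `R`-span of the products of fewer than `d` variables. -/
def wordFiltration (R : Subring A) (x : Fin n → A) (d : ℕ) : Submodule R A :=
  Submodule.span R {a | ∃ w : List (Fin n), w.length < d ∧ wordProd x w = a}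

theorem wordProd_mem {w : List (Fin n)} {d : ℕ} (h : w.length < d) :
    wordProd x w ∈ wordFiltration R x d :=
  Submodule.subset_span ⟨w, h, rfl⟩

theorem coe_mul_mem {N : Submodule R A} (r : R) {a : A} (h : a ∈ N) : (r : A) * a ∈ N :=
  N.smul_mem r h

theorem wordFiltration_mono {d e : ℕ} (h : d ≤ e) :
    wordFiltration R x d ≤ wordFiltration R x e := by
  apply Submodule.span_mono
  rintro _ ⟨w, hw, rfl⟩
  exact ⟨w, hw.trans_le h, rfl⟩

theorem var_mul_mem (hA : IsSkewPBWExtension R x) (i : Fin n) {d : ℕ} {a : A}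
    (h : a ∈ wordFiltration R x d) : x i * a ∈ wordFiltration R x (d + 1) := by
  induction h using Submodule.span_induction with
  | mem a ha =>
    obtain ⟨w, hw, rfl⟩ := ha
    rw [← wordProd_cons]
    exact wordProd_mem (by simpa using hw)
  | zero => simp
  | add a b _ _ ha hb => rw [mul_add]; exact add_mem ha hb
  | smul r a hm ha =>
    obtain ⟨s, t, hst, -⟩ := exists_mul_coe hA i r
    rw [subring_smul, ← mul_assoc, hst, add_mul, mul_assoc]
    exact add_mem (coe_mul_mem s ha) (coe_mul_mem t (wordFiltration_mono (Nat.le_succ d) hm))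

theorem mul_wordProd_mem (v : List (Fin n)) {d : ℕ} {a : A}
    (h : a ∈ wordFiltration R x d) : a * wordProd x v ∈ wordFiltration R x (d + v.length) := by
  induction h using Submodule.span_induction with
  | mem a ha =>
    obtain ⟨w, hw, rfl⟩ := ha
    rw [← wordProd_append]
    exact wordProd_mem (by simpa using hw)
  | zero => simp
  | add a b _ _ ha hb => rw [add_mul]; exact add_mem ha hb
  | smul r a _ ha =>
    rw [subring_smul, mul_assoc]
    exact coe_mul_mem r ha

/-! ### Leading forms -/

/-- With `eR` the annihilator of `a`, `es = s`. Since `e` commutes with `x i`, the leading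
coefficient of `x i * (er - r)` is `es - s = 0`, so `er = r`. -/
theorem mul_eq_zero_of_twist (hA : IsSkewPBWExtension R x) (hR : IsSkewArmendariz R x)
    (h : ∀ a : R, HasCentralAnnihilator {a}) {i : Fin n} {r s t a : R}
    (hst : x i * r = s * x i + t) (has : a * s = 0) : a * r = 0 := by
  obtain ⟨e, he, -, hr⟩ := h a
  have h1 : e * s = s := (hr s).1 (by simpa using has)
  obtain ⟨s', t', hst', hz⟩ := exists_mul_coe hA i (e * r - r)
  have h2 : (s' : A) * x i + t' = (0 : R) * x i + (e * t - t : R) := by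
    rw [← hst']
    push_cast
    rw [mul_sub, ← mul_assoc, var_mul_idempotent hA hR i he, mul_assoc, hst, mul_add, ← mul_assoc,
      ← Subring.coe_mul, h1]
    noncomm_ring
  have h3 := sub_eq_zero.1 (hz (var_linear_ext hA h2).1)
  exact (hr r).2 h3 a rfl

/-- Modulo shorter words, a coefficient moves left past a word; the second clause lets annihilation
of the new coefficient be pulled back to `r`. -/
theorem exists_wordProd_mul (hA : IsSkewPBWExtension R x) (hR : IsSkewArmendariz R x)
    (h : ∀ a : R, HasCentralAnnihilator {a}) (w : List (Fin n)) (r : R) :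
    ∃ s : R, wordProd x w * r - s * wordProd x w ∈ wordFiltration R x w.length ∧
      ∀ a : R, a * s = 0 → a * r = 0 := by
  induction w with
  | nil => exact ⟨r, by simp [wordProd], fun _ h => h⟩
  | cons i w ih =>
    obtain ⟨s, hs, hz⟩ := ih
    obtain ⟨s', t, hst, -⟩ := exists_mul_coe hA i s
    refine ⟨s', ?_, fun a ha => hz a (mul_eq_zero_of_twist hA hR h hst ha)⟩
    have : wordProd x (i :: w) * r - s' * wordProd x (i :: w) =
        x i * (wordProd x w * r - s * wordProd x w) + t * wordProd x w := by
      rw [wordProd_cons, mul_sub, ← mul_assoc (x i) (s : A), hst]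
      noncomm_ring
    rw [this]
    exact add_mem (var_mul_mem hA i hs) (coe_mul_mem t (wordProd_mem (by simp)))

theorem coeff_linear_eq_zero (hA : IsSkewPBWExtension R x) {γ : Fin n → ℕ} (hγ : 2 ≤ ∑ i, γ i)
    (r₀ : R) (r : Fin n → R) : hA.coeff ((r₀ : A) + ∑ k, (r k : A) * x k) γ = 0 := by
  have h0 : (0 : Fin n → ℕ) ≠ γ := by rintro rfl; simp at hγ
  have h1 : ∀ k, (Pi.single k 1 : Fin n → ℕ) ≠ γ := by rintro k rfl; simp at hγ
  simp only [map_add, map_sum, coeff_mul, coeff_var, coeff_coe]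
  simp [h0, h1]

theorem coeff_var_mul_var (hA : IsSkewPBWExtension R x) {i j : Fin n} (hij : i ≤ j) :
    ∃ γ : Fin n → ℕ, 2 ≤ ∑ k, γ k ∧ hA.coeff (x i * x j) = Finsupp.single γ 1 := by
  refine ⟨fun k => [i, j].count k, ?_, ?_⟩
  · rw [← length_standardWord, ← (perm_standardWord_count [i, j]).length_eq]
    rfl
  · rw [← coeff_standardMonomial hA, ← wordProd_eq_standardMonomial (x := x) (by simpa using hij)]
    simp [wordProd]

theorem commutation_mul_eq_one (hA : IsSkewPBWExtension R x) {i j : Fin n} (hij : i ≤ j)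
    {c c' r₀ r₀' : R} {r r' : Fin n → R}
    (h : x j * x i - (c : A) * (x i * x j) = (r₀ : A) + ∑ k, (r k : A) * x k)
    (h' : x i * x j - (c' : A) * (x j * x i) = (r₀' : A) + ∑ k, (r' k : A) * x k) :
    c' * c = 1 := by
  obtain ⟨γ, hγ, hc⟩ := coeff_var_mul_var hA hij
  have h1 := congrArg (fun a => hA.coeff a γ) h
  have h2 := congrArg (fun a => hA.coeff a γ) h'
  simp only [map_sub, coeff_mul, hc, coeff_linear_eq_zero hA hγ, Finsupp.sub_apply,
    Finsupp.smul_apply, Finsupp.single_eq_same, smul_eq_mul, mul_one, sub_eq_zero] at h1 h2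
  rw [h2, h1]

/-- Comparing the relations for both orders of the pair gives a one-sided inverse of `c`; when it
lies on the wrong side, reducedness allows `ac = 0` to be swapped. -/
theorem commutation_right_regular (hA : IsSkewPBWExtension R x)
    (hred : ∀ a : R, a * a = 0 → a = 0) {i j : Fin n} {c r₀ : R} {r : Fin n → R}
    (h : x j * x i - (c : A) * (x i * x j) = (r₀ : A) + ∑ k, (r k : A) * x k)
    (a : R) (ha : a * c = 0) : a = 0 := by
  obtain ⟨c', -, r₀', r', h'⟩ := hA.exists_mul_var j i
  rcases le_total i j with hij | hij
  · have h1 := commutation_mul_eq_one hA hij h h'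
    rw [← one_mul a, ← h1, mul_assoc, mul_eq_zero_swap hred ha, mul_zero]
  · have h1 := commutation_mul_eq_one hA hij h' h
    rw [← mul_one a, ← h1, ← mul_assoc, ha, zero_mul]

/-- Reordering a word costs only shorter words and a coefficient `u` that nothing nonzero
annihilates from the left. -/
theorem exists_wordProd_perm (hA : IsSkewPBWExtension R x) (hR : IsSkewArmendariz R x)
    (h : ∀ a : R, HasCentralAnnihilator {a}) {v w : List (Fin n)} (hvw : v.Perm w) :
    ∃ u : R, wordProd x v - u * wordProd x w ∈ wordFiltration R x v.length ∧
      ∀ a : R, a * u = 0 → a = 0 := by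
  induction hvw with
  | nil => exact ⟨1, by simp, fun a ha => by simpa using ha⟩
  | @cons i v w hp ih =>
    obtain ⟨u, hu, hz⟩ := ih
    obtain ⟨s, t, hst, -⟩ := exists_mul_coe hA i u
    refine ⟨s, ?_, fun a ha => hz a (mul_eq_zero_of_twist hA hR h hst ha)⟩
    have : wordProd x (i :: v) - s * wordProd x (i :: w) =
        x i * (wordProd x v - u * wordProd x w) + t * wordProd x w := by
      rw [wordProd_cons, wordProd_cons, mul_sub, ← mul_assoc (x i) (u : A), hst]
      noncomm_ring
    rw [this]
    exact add_mem (var_mul_mem hA i hu)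
      (coe_mul_mem t (wordProd_mem (by simp [hp.length_eq])))
  | swap i j w =>
    obtain ⟨c, -, r₀, r, hc⟩ := hA.exists_mul_var i j
    refine ⟨c, ?_, commutation_right_regular hA (fun _ => eq_zero_of_mul_self h) hc⟩
    have : wordProd x (j :: i :: w) - c * wordProd x (i :: j :: w) =
        ((r₀ : A) + ∑ k, (r k : A) * x k) * wordProd x w := by
      simp only [wordProd_cons]
      rw [← hc]
      noncomm_ring
    rw [this, add_mul, Finset.sum_mul]
    refine add_mem (coe_mul_mem r₀ (wordProd_mem (by simp)))
      (sum_mem fun k _ => ?_)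
    rw [mul_assoc, ← wordProd_cons]
    exact coe_mul_mem _ (wordProd_mem (by simp))
  | @trans v w z hp _ ih1 ih2 =>
    obtain ⟨u, hu, hz⟩ := ih1
    obtain ⟨u', hu', hz'⟩ := ih2
    refine ⟨u * u', ?_, fun a ha => hz a (hz' _ (by rw [mul_assoc, ha]))⟩
    have : wordProd x v - (u * u' : R) * wordProd x z =
        (wordProd x v - u * wordProd x w) + u * (wordProd x w - u' * wordProd x z) := by
      push_cast
      noncomm_ring
    rw [this]
    refine add_mem hu (coe_mul_mem u ?_)
    rwa [hp.length_eq]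

/-- Sorting a word leaves a multiple of a standard monomial of the same degree plus shorter words,
which are handled by induction. -/
theorem coeff_eq_zero_of_mem (hA : IsSkewPBWExtension R x) (hR : IsSkewArmendariz R x)
    (h : ∀ a : R, HasCentralAnnihilator {a}) {d : ℕ} {f : A} (hf : f ∈ wordFiltration R x d)
    {γ : Fin n → ℕ} (hγ : d ≤ ∑ i, γ i) : hA.coeff f γ = 0 := by
  induction d generalizing f γ with
  | zero =>
    have : f = 0 := by simpa [wordFiltration] using hf
    simp [this]
  | succ d ih =>
    induction hf using Submodule.span_induction with
    | mem f hf =>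
      obtain ⟨w, hw, rfl⟩ := hf
      obtain ⟨u, hu, -⟩ := exists_wordProd_perm hA hR h (perm_standardWord_count w)
      have h1 := ih (wordFiltration_mono (Nat.lt_succ_iff.1 hw) hu) ((Nat.le_succ d).trans hγ)
      have h2 : (fun i => w.count i) ≠ γ := by
        rintro rfl
        rw [← length_standardWord, ← (perm_standardWord_count w).length_eq] at hγ
        omega
      rw [wordProd_standardWord, map_sub, coeff_mul, coeff_standardMonomial, Finsupp.sub_apply,
        Finsupp.smul_apply, Finsupp.single_eq_of_ne h2.symm, smul_zero, sub_zero] at h1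
      exact h1
    | zero => simp
    | add f g _ _ hf hg => rw [map_add, Finsupp.add_apply, hf, hg, add_zero]
    | smul r f _ hf => rw [map_smul, Finsupp.smul_apply, hf, smul_zero]

theorem exists_standardMonomial_mul (hA : IsSkewPBWExtension R x) (hR : IsSkewArmendariz R x)
    (h : ∀ a : R, HasCentralAnnihilator {a}) (α β : Fin n → ℕ) (r : R) :
    ∃ t : R, standardMonomial x α * (r * standardMonomial x β) - t * standardMonomial x (α + β) ∈
        wordFiltration R x (∑ i, (α + β) i) ∧ ∀ a : R, a * t = 0 → a * r = 0 := by
  obtain ⟨s, hs, hz⟩ := exists_wordProd_mul hA hR h (standardWord α) r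
  have hp : (standardWord α ++ standardWord β).Perm (standardWord (α + β)) := by
    rw [List.perm_iff_count]
    intro i
    simp [count_standardWord]
  obtain ⟨u, hu, hz'⟩ := exists_wordProd_perm hA hR h hp
  refine ⟨s * u, ?_, fun a ha => hz a (hz' _ (by rw [mul_assoc, ha]))⟩
  have h1 := mul_wordProd_mem (standardWord β) hs
  rw [← List.length_append, hp.length_eq, length_standardWord] at h1
  rw [hp.length_eq, length_standardWord] at hu
  have h2 := add_mem h1 (coe_mul_mem s hu)
  convert h2 using 1
  simp only [wordProd_append, wordProd_standardWord]
  push_cast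
  noncomm_ring

/-- By maximality and uniqueness only the pair `(α₀, β₀)` contributes to the coefficient of `fg` at
`α₀ + β₀`. -/
theorem leading_coeff_mul_eq_zero (hA : IsSkewPBWExtension R x) (hR : IsSkewArmendariz R x)
    (h : ∀ a : R, HasCentralAnnihilator {a}) {f g : A} (hfg : f * g = 0) {α₀ β₀ : Fin n → ℕ}
    (hα₀ : α₀ ∈ (hA.coeff f).support) (hβ₀ : β₀ ∈ (hA.coeff g).support)
    (hα : ∀ α ∈ (hA.coeff f).support, ∑ i, α i ≤ ∑ i, α₀ i)
    (hβ : ∀ β ∈ (hA.coeff g).support, ∑ i, β i ≤ ∑ i, β₀ i)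
    (huniq : ∀ α ∈ (hA.coeff f).support, ∀ β ∈ (hA.coeff g).support,
      α + β = α₀ + β₀ → α = α₀ ∧ β = β₀) :
    hA.coeff f α₀ * hA.coeff g β₀ = 0 := by
  choose t ht hz using exists_standardMonomial_mul hA hR h
  have hterm : ∀ α ∈ (hA.coeff f).support, ∀ β ∈ (hA.coeff g).support,
      hA.coeff (standardMonomial x α * (hA.coeff g β * standardMonomial x β)) (α₀ + β₀) =
        t α β (hA.coeff g β) * Finsupp.single (α + β) (1 : R) (α₀ + β₀) := by
    intro α hα' β hβ'
    have h1 := coeff_eq_zero_of_mem hA hR h (ht α β (hA.coeff g β)) (γ := α₀ + β₀) (by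
      simp only [Pi.add_apply, Finset.sum_add_distrib]
      exact add_le_add (hα α hα') (hβ β hβ'))
    rw [map_sub, coeff_mul, coeff_standardMonomial, Finsupp.sub_apply, sub_eq_zero] at h1
    exact h1
  apply hz α₀ β₀
  have h2 : hA.coeff (f * g) (α₀ + β₀) = 0 := by rw [hfg]; simp
  have h3 : f * g = ∑ α ∈ (hA.coeff f).support, ∑ β ∈ (hA.coeff g).support,
      (hA.coeff f α : A) * (standardMonomial x α * (hA.coeff g β * standardMonomial x β)) := by
    conv_lhs => rw [eq_sum_coeff hA f, eq_sum_coeff hA g, Finset.sum_mul_sum]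
    simp only [mul_assoc]
  rw [h3] at h2
  simp only [map_sum, coeff_mul, Finsupp.finsetSum_apply, Finsupp.smul_apply, smul_eq_mul] at h2
  rw [Finset.sum_eq_single_of_mem α₀ hα₀, Finset.sum_eq_single_of_mem β₀ hβ₀,
    hterm _ hα₀ _ hβ₀, Finsupp.single_eq_same, mul_one] at h2
  · exact h2
  · intro β hβ' hne
    rw [hterm _ hα₀ _ hβ', Finsupp.single_eq_of_ne, mul_zero, mul_zero]
    exact fun heq => hne (huniq _ hα₀ _ hβ' heq.symm).2
  · intro α hα' hne
    refine Finset.sum_eq_zero fun β hβ' => ?_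
    rw [hterm _ hα' _ hβ', Finsupp.single_eq_of_ne, mul_zero, mul_zero]
    exact fun heq => hne (huniq _ hα' _ hβ' heq.symm).1

theorem exists_leading_pair {S T : Finset (Fin n → ℕ)} (hS : S.Nonempty) (hT : T.Nonempty) :
    ∃ α₀ ∈ S, ∃ β₀ ∈ T, (∀ α ∈ S, ∑ i, α i ≤ ∑ i, α₀ i) ∧ (∀ β ∈ T, ∑ i, β i ≤ ∑ i, β₀ i) ∧
      ∀ α ∈ S, ∀ β ∈ T, α + β = α₀ + β₀ → α = α₀ ∧ β = β₀ := by
  classical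
  obtain ⟨α₁, hα₁, hmα⟩ := S.exists_max_image (fun α => ∑ i, α i) hS
  obtain ⟨β₁, hβ₁, hmβ⟩ := T.exists_max_image (fun α => ∑ i, α i) hT
  -- Total degree does not single out one exponent, so a uniquely attained sum is chosen among the
  -- top-degree parts.
  obtain ⟨α₀, hα₀, β₀, hβ₀, huniq⟩ := UniqueSums.uniqueAdd_of_nonempty
    (A := S.filter fun α => ∑ i, α i = ∑ i, α₁ i) (B := T.filter fun α => ∑ i, α i = ∑ i, β₁ i)
    ⟨α₁, by simp [hα₁]⟩ ⟨β₁, by simp [hβ₁]⟩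
  rw [Finset.mem_filter] at hα₀ hβ₀
  refine ⟨α₀, hα₀.1, β₀, hβ₀.1, fun α h => hα₀.2 ▸ hmα α h, fun β h => hβ₀.2 ▸ hmβ β h, ?_⟩
  intro α hα β hβ heq
  have h1 := congrArg (fun γ : Fin n → ℕ => ∑ i, γ i) heq
  simp only [Pi.add_apply, Finset.sum_add_distrib] at h1
  have h2 := hmα α hα
  have h3 := hmβ β hβ
  exact huniq (Finset.mem_filter.2 ⟨hα, by omega⟩) (Finset.mem_filter.2 ⟨hβ, by omega⟩) heq

theorem card_support_coeff_mul_le (hA : IsSkewPBWExtension R x) (e : R) (f : A) :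
    (hA.coeff (e * f)).support.card ≤ (hA.coeff f).support.card := by
  rw [coeff_mul]
  exact Finset.card_le_card Finsupp.support_smul

theorem card_support_coeff_mul_lt (hA : IsSkewPBWExtension R x) {e : R} {f : A} {α : Fin n → ℕ}
    (hα : α ∈ (hA.coeff f).support) (he : e * hA.coeff f α = 0) :
    (hA.coeff (e * f)).support.card < (hA.coeff f).support.card := by
  rw [coeff_mul]
  refine Finset.card_lt_card ⟨Finsupp.support_smul, fun hle => ?_⟩
  have := hle hα
  simp [he] at this

/-- Induction on the total number of terms. With `eR` the annihilator of the leading coefficient of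
`f`, multiplication by `e` removes that term from `f`, and multiplication by `1 - e` removes the
leading term of `g`; the two conclusions add up. -/
theorem coeff_mul_coeff_eq_zero (hA : IsSkewPBWExtension R x) (hR : IsSkewArmendariz R x)
    (h : ∀ a : R, HasCentralAnnihilator {a}) {f g : A} (hfg : f * g = 0) (α β : Fin n → ℕ) :
    hA.coeff f α * hA.coeff g β = 0 := by
  induction hN : (hA.coeff f).support.card + (hA.coeff g).support.card using
    Nat.strong_induction_on generalizing f g with
  | h N ih =>
  rcases (hA.coeff f).support.eq_empty_or_nonempty with hf | hf
  · rw [Finsupp.support_eq_empty.1 hf]; simp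
  rcases (hA.coeff g).support.eq_empty_or_nonempty with hg | hg
  · rw [Finsupp.support_eq_empty.1 hg]; simp
  obtain ⟨α₀, hα₀, β₀, hβ₀, hmα, hmβ, huniq⟩ := exists_leading_pair hf hg
  have hzero := leading_coeff_mul_eq_zero hA hR h hfg hα₀ hβ₀ hmα hmβ huniq
  obtain ⟨e, he, hc, hr⟩ := h (hA.coeff f α₀)
  have step : ∀ d : R, d * d = d → (∀ b, d * b = b * d) →
      (hA.coeff (d * f)).support.card + (hA.coeff (d * g)).support.card < N →
      d * (hA.coeff f α * hA.coeff g β) = 0 := by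
    intro d hd hdc hlt
    have h1 : (d : A) * f * (d * g) = 0 := by
      rw [mul_assoc, ← mul_assoc f, ← idempotent_central hA hR hd hdc, mul_assoc, hfg, mul_zero,
        mul_zero]
    have h2 := ih _ hlt h1 rfl
    rw [coeff_mul, coeff_mul, Finsupp.smul_apply, Finsupp.smul_apply, smul_eq_mul, smul_eq_mul,
      mul_assoc, ← mul_assoc _ d, ← hdc, mul_assoc, ← mul_assoc, hd] at h2
    exact h2
  have h1 := step e he hc <| hN ▸ add_lt_add_of_lt_of_le
    (card_support_coeff_mul_lt hA hα₀ (by rw [hc]; exact (hr e).2 he _ rfl))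
    (card_support_coeff_mul_le hA e g)
  have h2 := step (1 - e) (by rw [mul_sub, sub_mul, sub_mul, he]; simp)
    (fun b => by rw [sub_mul, mul_sub, hc]; simp) <| hN ▸ add_lt_add_of_le_of_lt
    (card_support_coeff_mul_le hA (1 - e) f)
    (card_support_coeff_mul_lt hA hβ₀ (by
      rw [sub_mul, (hr _).1 (by simpa using hzero), one_mul, sub_self]))
  rw [sub_mul, h1, sub_zero, one_mul] at h2
  exact h2

/-! ### Transfer of central annihilators -/

/-- The idempotent for the coefficients serves for `S` too. Only coefficients in the support are
used, so a singleton `S` yields a finite set. -/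
theorem hasCentralAnnihilator_of_coeff (hA : IsSkewPBWExtension R x) (hR : IsSkewArmendariz R x)
    (h : ∀ a : R, HasCentralAnnihilator {a}) {S : Set A}
    (hS : HasCentralAnnihilator {r : R | ∃ f ∈ S, ∃ α ∈ (hA.coeff f).support, hA.coeff f α = r}) :
    HasCentralAnnihilator S := by
  obtain ⟨e, he, hc, hr⟩ := hS
  have hcA := idempotent_central hA hR he hc
  refine ⟨e, by exact_mod_cast congrArg Subtype.val he, hcA, fun g => ⟨fun hg => ?_, ?_⟩⟩
  · apply coeff_injective hA
    ext1 β
    rw [coeff_mul, Finsupp.smul_apply, smul_eq_mul, ← hr]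
    rintro _ ⟨f, hf, α, -, rfl⟩
    exact coeff_mul_coeff_eq_zero hA hR h (hg f hf) α β
  · intro hg f hf
    have h1 : (e : A) * f = 0 := by
      apply coeff_injective hA
      ext1 α
      rw [coeff_mul, map_zero, Finsupp.smul_apply, smul_eq_mul, Finsupp.zero_apply]
      by_cases hα : hA.coeff f α = 0
      · rw [hα, mul_zero]
      · rw [hc]
        exact (hr e).2 he _ ⟨f, hf, α, Finsupp.mem_support_iff.2 hα, rfl⟩
    rw [← hg, ← mul_assoc, ← hcA, h1, zero_mul]

theorem hasCentralAnnihilator_singleton (hA : IsSkewPBWExtension R x) (hR : IsSkewArmendariz R x)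
    (h : ∀ a : R, HasCentralAnnihilator {a}) (f : A) : HasCentralAnnihilator {f} := by
  classical
  apply hasCentralAnnihilator_of_coeff hA hR h
  convert hasCentralAnnihilator_finset h ((hA.coeff f).support.image (hA.coeff f)) using 1
  ext r
  simp

theorem hasCentralAnnihilator_subring (hA : IsSkewPBWExtension R x) (hR : IsSkewArmendariz R x)
    {S : Set R} (h : HasCentralAnnihilator (Subtype.val '' S)) : HasCentralAnnihilator S := by
  obtain ⟨e, he, hc, hr⟩ := h
  refine ⟨⟨e, idempotent_mem hA hR he⟩, Subtype.ext he, fun b => Subtype.ext (hc b), fun b => ?_⟩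
  have := hr b
  simp only [Set.forall_mem_image] at this
  rw [Subtype.ext_iff, Subring.coe_mul, ← this]
  refine forall₂_congr fun s _ => ?_
  rw [Subtype.ext_iff]
  rfl

theorem forall_hasCentralAnnihilator_singleton_iff (hA : IsSkewPBWExtension R x)
    (hR : IsSkewArmendariz R x) :
    (∀ a : R, HasCentralAnnihilator {a}) ↔ ∀ a : A, HasCentralAnnihilator {a} :=
  ⟨hasCentralAnnihilator_singleton hA hR, fun h a =>
    hasCentralAnnihilator_subring hA hR (by rw [Set.image_singleton]; exact h _)⟩

theorem forall_hasCentralAnnihilator_iff (hA : IsSkewPBWExtension R x)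
    (hR : IsSkewArmendariz R x) :
    (∀ S : Set R, HasCentralAnnihilator S) ↔ ∀ S : Set A, HasCentralAnnihilator S :=
  ⟨fun h _ => hasCentralAnnihilator_of_coeff hA hR (fun a => h {a}) (h _), fun h _ =>
    hasCentralAnnihilator_subring hA hR (h _)⟩

end SkewPBW

theorem mainTheorem4 {A : Type*} [Ring A] (R : Subring A) {n : ℕ} (x : Fin n → A)
    (hA : IsSkewPBWExtension R x) (hR : IsSkewArmendariz R x) :
    ((IsQuasiBaer R ∧ HasIFP R) ↔ (IsQuasiBaer A ∧ HasIFP A)) ∧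
    ((IsRightPQBaer R ∧ HasIFP R) ↔ (IsRightPQBaer A ∧ HasIFP A)) ∧
    ((IsLeftPQBaer R ∧ HasIFP R) ↔ (IsLeftPQBaer A ∧ HasIFP A)) := by
  simp only [isQuasiBaer_and_hasIFP_iff, isRightPQBaer_and_hasIFP_iff,
    isLeftPQBaer_and_hasIFP_iff]
  exact ⟨forall_hasCentralAnnihilator_iff hA hR, forall_hasCentralAnnihilator_singleton_iff hA hR,
    forall_hasCentralAnnihilator_singleton_iff hA hR⟩
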